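/- Let $\mathcal H$ be a complex Hilbert space with inner product $\langle\cdot,\cdot\rangle$ linear in the second argument, and let $K$ be a bounded and boundedly invertible linear operator on $\mathcal H$. A densely defined closable operator $T$ in $\mathcal H$ is called $K$-invariant if $K^*TK=T$ as operators, that is, $\mathcal D(T)=\{f\in\mathcal H : Kf\in\mathcal D(T)\}$ and $K^*TKf=Tf$ for all $f\in\mathcal D(T)$. Let $A$ be a densely defined sectorial operator in $\mathcal H$: there is $\eta\in[0,\pi/2)$ such that the numerical range $\{\langle\psi,A\psi\rangle : \psi\in\mathcal D(A),\ \|\psi\|=1\}$ is contained in the closed sector $\{0\}\cup\{z\in\mathbb C\setminus\{0\} : -\eta\le\arg z\le\eta\}$. Let $\mathcal Q(A)$ be the set of all $u\in\mathcal H$ for which there is a sequence $(u_n)$ in $\mathcal D(A)$ that converges to $u$ in $\mathcal H$ and is Cauchy with respect to the norm $\|\psi\|_A=(\|\psi\|^2+\operatorname{Re}\langle\psi,A\psi\rangle)^{1/2}$ (we say that $(u_n)$ approximates $u$). For $u,v\in\mathcal Q(A)$ let $\overline{\mathfrak a}[u,v]=\lim_{n\to\infty}\langle u_n,Av_n\rangle$,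 where $(u_n)$ and $(v_n)$ approximate $u$ and $v$; the limit exists and does not depend on the chosen sequences. The Friedrichs extension $A_F$ of $A$ is the operator associated with the closed form $\overline{\mathfrak a}$: $u\in\mathcal D(A_F)$ and $A_Fu=w$ if and only if $u\in\mathcal Q(A)$ and $\overline{\mathfrak a}[v,u]=\langle v,w\rangle$ for all $v\in\mathcal Q(A)$. Theorem. If $K^*AK=A$, then the Friedrichs extension $A_F$ is $K$-invariant; that is, $A_F$ is densely defined and closable, and $K^*A_FK=A_F$. -/

import Mathlib

open Filter Topology

noncomputable section

namespace KInv

section Basic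

variable {H : Type*} [NormedAddCommGroup H] [InnerProductSpace ℂ H]

/-- The numerical range `{⟨ψ, Aψ⟩ | ψ ∈ D(A), ‖ψ‖ = 1}` of an operator `A`. -/
def numericalRange (A : H →ₗ.[ℂ] H) : Set ℂ :=
  {z | ∃ ψ : A.domain, ‖(ψ : H)‖ = 1 ∧ inner ℂ (ψ : H) (A ψ) = z}

/-- `A` is sectorial: it is densely defined and its numerical range is contained in a closed sector
`{z | -η ≤ arg z ≤ η}` with vertex `0` and semi-angle `η ∈ [0, π/2)`.
The vertex belongs to the sector (`Complex.arg 0 = 0`). -/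
structure IsSectorial (A : H →ₗ.[ℂ] H) : Prop where
  dense_domain : Dense (A.domain : Set H)
  numericalRange_subset : ∃ η : ℝ, 0 ≤ η ∧ η < Real.pi / 2 ∧
    numericalRange A ⊆ {z : ℂ | -η ≤ z.arg ∧ z.arg ≤ η}

/-- The sesquilinear form `(u, v) ↦ ⟨u, Av⟩` on `D(A)` (antilinear in `u`, linear in `v`). -/
def form (A : H →ₗ.[ℂ] H) (u v : A.domain) : ℂ := inner ℂ (u : H) (A v)

/-- The form norm `‖ψ‖_A = (‖ψ‖² + Re ⟨ψ, Aψ⟩)^{1/2}` on `D(A)`. -/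
def formNorm (A : H →ₗ.[ℂ] H) (ψ : A.domain) : ℝ :=
  √(‖(ψ : H)‖ ^ 2 + (form A ψ ψ).re)

/-- The sequence `f` in `D(A)` converges to `u` in `H` and is Cauchy for the form norm `‖·‖_A`. -/
def FormConverges (A : H →ₗ.[ℂ] H) (f : ℕ → A.domain) (u : H) : Prop :=
  Tendsto (fun n => (f n : H)) atTop (𝓝 u) ∧
    Tendsto (fun p : ℕ × ℕ => formNorm A (f p.1 - f p.2)) atTop (𝓝 0)

section helpers

variable {A : H →ₗ.[ℂ] H}

lemma form_add_left (u v w : A.domain) : form A (u + v) w = form A u w + form A v w := by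
  simp [form]

lemma form_add_right (u v w : A.domain) : form A u (v + w) = form A u v + form A u w := by
  simp [form, LinearPMap.map_add]

lemma form_sub_left (u v w : A.domain) : form A (u - v) w = form A u w - form A v w := by
  simp [form]

lemma form_sub_right (u v w : A.domain) : form A u (v - w) = form A u v - form A u w := by
  simp [form, LinearPMap.map_sub]

lemma form_smul_left (c : ℂ) (u v : A.domain) :
    form A (c • u) v = (starRingEnd ℂ) c * form A u v := by
  simp only [form, Submodule.coe_smul, inner_smul_left]

lemma form_smul_right (c : ℂ) (u v : A.domain) : form A u (c • v) = c * form A u v := by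
  simp [form, LinearPMap.map_smul]

/-- A sectorial form is bounded on the diagonal by its real part. -/
lemma IsSectorial.exists_bound (hA : IsSectorial A) :
    ∃ M : ℝ, 0 ≤ M ∧ ∀ u : A.domain, 0 ≤ (form A u u).re ∧ ‖form A u u‖ ≤ M * (form A u u).re := by
  obtain ⟨η, h0, h1, hs⟩ := hA.numericalRange_subset
  have hc : 0 < Real.cos η := Real.cos_pos_of_mem_Ioo ⟨by linarith [Real.pi_pos], h1⟩
  refine ⟨(Real.cos η)⁻¹, by positivity, fun u => ?_⟩
  have key : Real.cos η * ‖form A u u‖ ≤ (form A u u).re := by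
    by_cases hu : (u : H) = 0
    · simp [form, hu]
    have hn : 0 < ‖(u : H)‖ := norm_pos_iff.2 hu
    set c : ℂ := ((‖(u : H)‖⁻¹ : ℝ) : ℂ) with hcdef
    have hmem : form A (c • u) (c • u) ∈ numericalRange A := by
      refine ⟨c • u, ?_, rfl⟩
      rw [Submodule.coe_smul, norm_smul, hcdef, Complex.norm_real, norm_inv, norm_norm]
      exact inv_mul_cancel₀ hn.ne'
    have harg := hs hmem
    have hval : form A (c • u) (c • u) = ((‖(u : H)‖⁻¹ ^ 2 : ℝ) : ℂ) * form A u u := by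
      rw [form_smul_left, form_smul_right, hcdef, Complex.conj_ofReal]
      push_cast
      ring
    rw [hval, Set.mem_ofPred_eq, Complex.arg_real_mul _ (by positivity)] at harg
    have hcos : Real.cos η ≤ Real.cos (form A u u).arg := by
      rw [← Real.cos_abs (form A u u).arg]
      exact Real.cos_le_cos_of_nonneg_of_le_pi (abs_nonneg _) (by linarith [Real.pi_pos])
        (abs_le.2 harg)
    calc Real.cos η * ‖form A u u‖ ≤ Real.cos (form A u u).arg * ‖form A u u‖ := by gcongr
      _ = (form A u u).re := by rw [mul_comm, Complex.norm_mul_cos_arg]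
  refine ⟨le_trans (by positivity) key, ?_⟩
  rw [inv_mul_eq_div, le_div_iff₀ hc, mul_comm]
  exact key

lemma IsSectorial.re_nonneg (hA : IsSectorial A) (u : A.domain) : 0 ≤ (form A u u).re :=
  (hA.exists_bound.choose_spec.2 u).1

lemma IsSectorial.re_sub_le (hA : IsSectorial A) (u v : A.domain) :
    (form A (u - v) (u - v)).re ≤ 2 * (form A u u).re + 2 * (form A v v).re := by
  have h := hA.re_nonneg (u + v)
  simp only [form_add_left, form_add_right, form_sub_left, form_sub_right, Complex.add_re,
    Complex.sub_re] at h ⊢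
  linarith

lemma IsSectorial.re_add_le (hA : IsSectorial A) (u v : A.domain) :
    (form A (u + v) (u + v)).re ≤ 2 * (form A u u).re + 2 * (form A v v).re := by
  have h := hA.re_nonneg (u - v)
  simp only [form_add_left, form_add_right, form_sub_left, form_sub_right, Complex.add_re,
    Complex.sub_re] at h ⊢
  linarith

/-- Off-diagonal bound for a sectorial form, by polarization. -/
lemma IsSectorial.exists_bound' (hA : IsSectorial A) :
    ∃ M : ℝ, 0 ≤ M ∧ ∀ (u v : A.domain) (t : ℝ), 0 < t →
      ‖form A u v‖ ≤ M * (t * (form A u u).re + t⁻¹ * (form A v v).re) := by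
  obtain ⟨M, hM, hb⟩ := hA.exists_bound
  have h1 : ∀ u v : A.domain, ‖form A u v‖ ≤ M * ((form A u u).re + (form A v v).re) := by
    intro u v
    have e : 4 * form A u v = form A (u + v) (u + v) - form A (u - v) (u - v)
        - Complex.I * form A (u + Complex.I • v) (u + Complex.I • v)
        + Complex.I * form A (u - Complex.I • v) (u - Complex.I • v) := by
      simp only [form_add_left, form_add_right, form_sub_left, form_sub_right, form_smul_left,
        form_smul_right, Complex.conj_I]
      linear_combination (2 * form A u v - 2 * form A v u) * Complex.I_sq
    have s : (form A (u + v) (u + v)).re + (form A (u - v) (u - v)).re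
        + (form A (u + Complex.I • v) (u + Complex.I • v)).re
        + (form A (u - Complex.I • v) (u - Complex.I • v)).re
        = 4 * ((form A u u).re + (form A v v).re) := by
      simp only [form_add_left, form_add_right, form_sub_left, form_sub_right, form_smul_left,
        form_smul_right, Complex.conj_I, Complex.add_re, Complex.sub_re, Complex.mul_re,
        Complex.I_re, Complex.I_im, Complex.neg_re, Complex.neg_im, Complex.add_im,
        Complex.sub_im, Complex.mul_im]
      ring
    have n4 : 4 * ‖form A u v‖ = ‖4 * form A u v‖ := by simp
    have hn : ‖4 * form A u v‖ ≤ ‖form A (u + v) (u + v)‖ + ‖form A (u - v) (u - v)‖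
        + ‖form A (u + Complex.I • v) (u + Complex.I • v)‖
        + ‖form A (u - Complex.I • v) (u - Complex.I • v)‖ := by
      rw [e]
      refine (norm_add_le _ _).trans (add_le_add ((norm_sub_le _ _).trans
        (add_le_add (norm_sub_le _ _) ?_)) ?_) <;> simp
    nlinarith [(hb (u + v)).2, (hb (u - v)).2, (hb (u + Complex.I • v)).2,
      (hb (u - Complex.I • v)).2]
  refine ⟨M, hM, fun u v t ht => ?_⟩
  have hs : √t * √t = t := Real.mul_self_sqrt ht.le
  have hs0 : √t ≠ 0 := (Real.sqrt_pos.2 ht).ne'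
  have h := h1 (((√t : ℝ) : ℂ) • u) ((((√t)⁻¹ : ℝ) : ℂ) • v)
  have e1 : form A (((√t : ℝ) : ℂ) • u) ((((√t)⁻¹ : ℝ) : ℂ) • v) = form A u v := by
    rw [form_smul_left, form_smul_right, Complex.conj_ofReal, ← mul_assoc, ← Complex.ofReal_mul,
      mul_inv_cancel₀ hs0, Complex.ofReal_one, one_mul]
  have e2 : ∀ (r : ℝ) (x : A.domain), (form A ((r : ℂ) • x) ((r : ℂ) • x)).re
      = r * r * (form A x x).re := by
    intro r x
    rw [form_smul_left, form_smul_right, Complex.conj_ofReal, ← mul_assoc, ← Complex.ofReal_mul,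
      Complex.re_ofReal_mul]
  rwa [e1, e2, e2, hs, ← mul_inv, hs] at h

lemma formConverges_iff (hA : IsSectorial A) (f : ℕ → A.domain) (u : H) :
    FormConverges A f u ↔ Tendsto (fun n => (f n : H)) atTop (𝓝 u) ∧
      Tendsto (fun p : ℕ × ℕ => (form A (f p.1 - f p.2) (f p.1 - f p.2)).re) atTop (𝓝 0) := by
  refine and_congr_right fun hf => ?_
  have hd : Tendsto (fun p : ℕ × ℕ => ‖((f p.1 - f p.2 : A.domain) : H)‖ ^ 2) atTop (𝓝 0) := by
    have h1 : Tendsto (fun p : ℕ × ℕ => (f p.1 : H) - (f p.2 : H)) atTop (𝓝 (u - u)) := by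
      rw [← prod_atTop_atTop_eq]
      exact (hf.comp tendsto_fst).sub (hf.comp tendsto_snd)
    simpa using (h1.norm.pow 2)
  constructor
  · intro h
    have h2 := (h.pow 2).sub hd
    simp only [ne_eq, OfNat.ofNat_ne_zero, not_false_eq_true, zero_pow, sub_zero] at h2
    refine h2.congr fun p => ?_
    rw [formNorm, Real.sq_sqrt (add_nonneg (sq_nonneg _) (hA.re_nonneg _))]
    ring
  · intro h
    have h2 := (hd.add h).sqrt
    simpa [formNorm] using h2

lemma FormConverges.add (hA : IsSectorial A) {f g : ℕ → A.domain} {u v : H}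
    (hf : FormConverges A f u) (hg : FormConverges A g v) :
    FormConverges A (fun n => f n + g n) (u + v) := by
  rw [formConverges_iff hA] at *
  refine ⟨by simpa using hf.1.add hg.1, ?_⟩
  have h := (hf.2.const_mul 2).add (hg.2.const_mul 2)
  simp only [mul_zero, add_zero] at h
  refine squeeze_zero (fun _ => hA.re_nonneg _) (fun p => ?_) h
  have e : f p.1 + g p.1 - (f p.2 + g p.2) = (f p.1 - f p.2) + (g p.1 - g p.2) := by abel
  rw [e]
  exact hA.re_add_le _ _

lemma FormConverges.smul (hA : IsSectorial A) (c : ℂ) {f : ℕ → A.domain} {u : H}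
    (hf : FormConverges A f u) : FormConverges A (fun n => c • f n) (c • u) := by
  rw [formConverges_iff hA] at *
  refine ⟨by simpa using hf.1.const_smul c, ?_⟩
  have h := hf.2.const_mul (Complex.normSq c)
  rw [mul_zero] at h
  refine h.congr fun p => ?_
  rw [← smul_sub, form_smul_left, form_smul_right, ← mul_assoc, mul_comm ((starRingEnd ℂ) c),
    Complex.mul_conj, Complex.re_ofReal_mul]

lemma formConverges_const (hA : IsSectorial A) (u : A.domain) :
    FormConverges A (fun _ => u) (u : H) := by
  rw [formConverges_iff hA]
  refine ⟨tendsto_const_nhds, ?_⟩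
  simp [form]

lemma FormConverges.sub (hA : IsSectorial A) {f g : ℕ → A.domain} {u v : H}
    (hf : FormConverges A f u) (hg : FormConverges A g v) :
    FormConverges A (fun n => f n - g n) (u - v) := by
  have := hf.add hA (hg.smul hA (-1))
  simpa [sub_eq_add_neg] using this

lemma FormConverges.exists_bound (hA : IsSectorial A) {f : ℕ → A.domain} {u : H}
    (hf : FormConverges A f u) :
    ∃ C : ℝ, 0 < C ∧ ∀ᶠ n in atTop, (form A (f n) (f n)).re ≤ C := by
  rw [formConverges_iff hA] at hf
  have h := hf.2.eventually (gt_mem_nhds (zero_lt_one' ℝ))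
  obtain ⟨⟨N, N'⟩, hN⟩ := eventually_atTop.1 h
  refine ⟨2 + 2 * (form A (f N') (f N')).re, by linarith [hA.re_nonneg (f N')], ?_⟩
  filter_upwards [eventually_ge_atTop N] with n hn
  have h1 := hN (n, N') ⟨hn, le_rfl⟩
  have h2 := hA.re_add_le (f n - f N') (f N')
  rw [sub_add_cancel] at h2
  simp only at h1
  linarith

/-- If the real part of the form stays bounded along `f` and tends to `0` along `g`, then the form
tends to `0` along `(f, g)` and along `(g, f)`. -/
lemma tendsto_form_zero (hA : IsSectorial A) {ι : Type*} {l : Filter ι} {f g : ι → A.domain}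
    {C : ℝ} (hC : 0 < C) (hf : ∀ᶠ i in l, (form A (f i) (f i)).re ≤ C)
    (hg : Tendsto (fun i => (form A (g i) (g i)).re) l (𝓝 0)) :
    Tendsto (fun i => form A (f i) (g i)) l (𝓝 0) ∧
      Tendsto (fun i => form A (g i) (f i)) l (𝓝 0) := by
  obtain ⟨M, hM, hb⟩ := hA.exists_bound'
  have main : ∀ ε > 0, ∀ᶠ i in l, ‖form A (f i) (g i)‖ < ε ∧ ‖form A (g i) (f i)‖ < ε := by
    intro ε hε
    set t : ℝ := ε / (2 * (M + 1) * C) with ht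
    have ht0 : 0 < t := by positivity
    have hMt : M * (t * C) < ε / 2 := by
      have e : t * C = ε / 2 / (M + 1) := by rw [ht]; field_simp
      rw [e, mul_div_assoc', div_lt_iff₀ (by positivity)]
      nlinarith
    have h1 := (hg.const_mul t⁻¹).const_mul M
    rw [mul_zero, mul_zero] at h1
    filter_upwards [hf, h1.eventually (gt_mem_nhds (half_pos hε))] with i hi hgi
    have hfi : M * (t * (form A (f i) (f i)).re) ≤ M * (t * C) := by gcongr
    have b1 := hb (f i) (g i) t ht0
    have b2 := hb (g i) (f i) t⁻¹ (inv_pos.2 ht0)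
    rw [inv_inv] at b2
    rw [mul_add] at b1 b2
    exact ⟨by linarith, by linarith⟩
  constructor <;> rw [Metric.tendsto_nhds] <;> intro ε hε <;>
    filter_upwards [main ε hε] with i hi <;> simp [hi.1, hi.2]

/-- Closability of the form of a sectorial operator. -/
lemma FormConverges.tendsto_zero (hA : IsSectorial A) {f : ℕ → A.domain}
    (hf : FormConverges A f 0) : Tendsto (fun n => (form A (f n) (f n)).re) atTop (𝓝 0) := by
  obtain ⟨C, hC, hb⟩ := hf.exists_bound hA
  rw [formConverges_iff hA] at hf
  have hb' : ∀ᶠ p : ℕ × ℕ in atTop, (form A (f p.1) (f p.1)).re ≤ C := by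
    rw [← prod_atTop_atTop_eq]
    exact tendsto_fst.eventually hb
  have h := (tendsto_form_zero hA hC hb' hf.2).1
  rw [Metric.tendsto_nhds]
  intro ε hε
  have h2 := (Metric.tendsto_nhds.1 h) (ε / 2) (half_pos hε)
  obtain ⟨⟨N, N'⟩, hN⟩ := eventually_atTop.1 h2
  have h3 : Tendsto (fun n => form A (f n) (f N')) atTop (𝓝 0) := by
    have := hf.1.inner (𝕜 := ℂ) (tendsto_const_nhds (x := A (f N')))
    simpa [form] using this
  filter_upwards [eventually_ge_atTop N, (Metric.tendsto_nhds.1 h3) (ε / 2) (half_pos hε)]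
    with n hn hn'
  have h4 := hN (n, N') ⟨hn, le_rfl⟩
  rw [dist_zero_right] at hn' h4 ⊢
  have e : form A (f n) (f n) = form A (f n) (f n - f N') + form A (f n) (f N') := by
    rw [form_sub_right]; ring
  calc ‖(form A (f n) (f n)).re‖ ≤ ‖form A (f n) (f n)‖ := Complex.abs_re_le_norm _
    _ ≤ ‖form A (f n) (f n - f N')‖ + ‖form A (f n) (f N')‖ := by
      rw [e]; exact norm_add_le _ _
    _ < ε := by linarith

/-- The form has a limit along any two form-convergent sequences. -/
lemma FormConverges.exists_tendsto (hA : IsSectorial A) {f g : ℕ → A.domain} {u v : H}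
    (hf : FormConverges A f u) (hg : FormConverges A g v) :
    ∃ z, Tendsto (fun n => form A (f n) (g n)) atTop (𝓝 z) := by
  obtain ⟨C, hC, hfb⟩ := hf.exists_bound hA
  obtain ⟨D, hD, hgb⟩ := hg.exists_bound hA
  rw [formConverges_iff hA] at hf hg
  refine cauchySeq_tendsto_of_complete ?_
  have h1 : Tendsto (fun p : ℕ × ℕ => form A (f p.2) (g p.1 - g p.2)) atTop (𝓝 0) := by
    refine (tendsto_form_zero hA hC ?_ hg.2).1
    rw [← prod_atTop_atTop_eq]
    exact tendsto_snd.eventually hfb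
  have h2 : Tendsto (fun p : ℕ × ℕ => form A (f p.1 - f p.2) (g p.1)) atTop (𝓝 0) := by
    refine (tendsto_form_zero hA hD ?_ hf.2).2
    rw [← prod_atTop_atTop_eq]
    exact tendsto_fst.eventually hgb
  rw [cauchySeq_iff_tendsto_dist_atTop_0]
  have h3 := (h2.add h1).norm
  rw [add_zero, norm_zero] at h3
  refine h3.congr fun p => ?_
  rw [dist_eq_norm, form_sub_left, form_sub_right]
  congr 1
  ring

/-- The limit of the form does not depend on the approximating sequences. -/
lemma FormConverges.tendsto_sub (hA : IsSectorial A) {f f' g g' : ℕ → A.domain} {u v : H}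
    (hf : FormConverges A f u) (hf' : FormConverges A f' u)
    (hg : FormConverges A g v) (hg' : FormConverges A g' v) :
    Tendsto (fun n => form A (f n) (g n) - form A (f' n) (g' n)) atTop (𝓝 0) := by
  obtain ⟨C, hC, hfb⟩ := hf'.exists_bound hA
  obtain ⟨D, hD, hgb⟩ := hg.exists_bound hA
  have d1 := hf.sub hA hf'
  have d2 := hg.sub hA hg'
  rw [sub_self] at d1 d2
  have h := (tendsto_form_zero hA hD hgb (d1.tendsto_zero hA)).2.add
    (tendsto_form_zero hA hC hfb (d2.tendsto_zero hA)).1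
  rw [add_zero] at h
  refine h.congr fun n => ?_
  rw [form_sub_left, form_sub_right]
  ring

end helpers

/-- The form domain `Q(A)`: the closure of `D(A)` with respect to the form norm, realised in `H`. -/
def formDomain (A : H →ₗ.[ℂ] H) (hA : IsSectorial A) : Submodule ℂ H where
  carrier := {u | ∃ f : ℕ → A.domain, FormConverges A f u}
  zero_mem' := ⟨fun _ => 0, by simpa using formConverges_const hA 0⟩
  add_mem' := fun ⟨_, hf⟩ ⟨_, hg⟩ => ⟨_, hf.add hA hg⟩
  smul_mem' := fun c _ ⟨_, hf⟩ => ⟨_, hf.smul hA c⟩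

/-- The closure on `Q(A)` of the form `(u, v) ↦ ⟨u, Av⟩`: the limit of `⟨u_n, A v_n⟩`, where `u_n`
and `v_n` are sequences in `D(A)` that converge to `u` and `v` in `H` and are Cauchy for the form
norm. The limit exists and does not depend on these sequences, see `tendsto_closedForm`. -/
def closedForm (A : H →ₗ.[ℂ] H) (hA : IsSectorial A) (u v : formDomain A hA) : ℂ :=
  limUnder atTop fun n => form A (u.2.choose n) (v.2.choose n)

lemma tendsto_closedForm {A : H →ₗ.[ℂ] H} (hA : IsSectorial A) (u v : formDomain A hA)
    {f g : ℕ → A.domain} (hf : FormConverges A f u) (hg : FormConverges A g v) :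
    Tendsto (fun n => form A (f n) (g n)) atTop (𝓝 (closedForm A hA u v)) := by
  have h := (u.2.choose_spec.exists_tendsto hA v.2.choose_spec)
  have h1 := tendsto_nhds_limUnder h
  have h2 := (hf.tendsto_sub hA u.2.choose_spec hg v.2.choose_spec).add h1
  rw [zero_add] at h2
  simpa [closedForm] using h2

lemma closedForm_add_right {A : H →ₗ.[ℂ] H} (hA : IsSectorial A) (u v w : formDomain A hA) :
    closedForm A hA u (v + w) = closedForm A hA u v + closedForm A hA u w := by
  obtain ⟨f, hf⟩ := u.2
  obtain ⟨g, hg⟩ := v.2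
  obtain ⟨k, hk⟩ := w.2
  refine tendsto_nhds_unique (tendsto_closedForm hA u (v + w) hf (hg.add hA hk)) ?_
  simpa only [form_add_right] using
    (tendsto_closedForm hA u v hf hg).add (tendsto_closedForm hA u w hf hk)

lemma closedForm_smul_right {A : H →ₗ.[ℂ] H} (hA : IsSectorial A) (c : ℂ)
    (u v : formDomain A hA) : closedForm A hA u (c • v) = c * closedForm A hA u v := by
  obtain ⟨f, hf⟩ := u.2
  obtain ⟨g, hg⟩ := v.2
  refine tendsto_nhds_unique (tendsto_closedForm hA u (c • v) hf (hg.smul hA c)) ?_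
  simpa only [form_smul_right] using (tendsto_closedForm hA u v hf hg).const_mul c

/-- The graph of the Friedrichs extension: all `(u, w)` with `u ∈ Q(A)` such that
`closedForm v u = ⟨v, w⟩` for all `v ∈ Q(A)`. -/
def friedrichsGraph (A : H →ₗ.[ℂ] H) (hA : IsSectorial A) : Submodule ℂ (H × H) where
  carrier := {p | ∃ u : formDomain A hA, (u : H) = p.1 ∧
    ∀ v : formDomain A hA, closedForm A hA v u = inner ℂ (v : H) p.2}
  zero_mem' := ⟨0, rfl, fun v => by
    have h := closedForm_smul_right hA 0 v 0
    rw [zero_smul, zero_mul] at h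
    simp [h]⟩
  add_mem' := by
    rintro p q ⟨u, hu, h⟩ ⟨u', hu', h'⟩
    exact ⟨u + u', by simp [hu, hu'], fun v => by
      rw [closedForm_add_right, h, h', Prod.snd_add, inner_add_right]⟩
  smul_mem' := by
    rintro c p ⟨u, hu, h⟩
    exact ⟨c • u, by simp [hu], fun v => by
      rw [closedForm_smul_right, h, Prod.smul_snd, inner_smul_right]⟩

/-- The Friedrichs extension `A_F` of a sectorial operator `A`: the operator associated with the
closure of the form `⟨u, Av⟩` by the first representation theorem. -/
def friedrichsExtension (A : H →ₗ.[ℂ] H) (hA : IsSectorial A) : H →ₗ.[ℂ] H :=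
  (friedrichsGraph A hA).toLinearPMap

lemma friedrichsExtension_graph (A : H →ₗ.[ℂ] H) (hA : IsSectorial A) :
    (friedrichsExtension A hA).graph = friedrichsGraph A hA := by
  refine Submodule.toLinearPMap_graph_eq _ ?_
  rintro ⟨x, w⟩ ⟨u, hu, h⟩ hx
  simp only at hu hx h
  have hu0 : u = 0 := Subtype.ext (hu.trans hx)
  have hz : ∀ v : formDomain A hA, inner ℂ (v : H) w = 0 := fun v => by
    have h1 := closedForm_smul_right hA 0 v 0
    rw [zero_smul, zero_mul] at h1
    rw [← h v, hu0, h1]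
  refine hA.dense_domain.eq_zero_of_inner_right (𝕜 := ℂ) fun v hv => ?_
  exact hz ⟨v, _, formConverges_const hA ⟨v, hv⟩⟩

/-- The Friedrichs extension is an extension. -/
lemma le_friedrichsExtension (A : H →ₗ.[ℂ] H) (hA : IsSectorial A) :
    A ≤ friedrichsExtension A hA := by
  refine LinearPMap.le_of_le_graph ?_
  rw [friedrichsExtension_graph]
  rintro ⟨x, y⟩ hxy
  obtain ⟨u, hu, hy⟩ := (LinearPMap.mem_graph_iff A).1 hxy
  simp only at hu hy
  have hc := formConverges_const hA u
  refine ⟨⟨u, _, hc⟩, hu, fun v => ?_⟩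
  obtain ⟨f, hf⟩ := v.2
  refine tendsto_nhds_unique (tendsto_closedForm hA v ⟨u, _, hc⟩ hf hc) ?_
  rw [← hy]
  exact hf.1.inner tendsto_const_nhds

end Basic

section Invariance

variable {H : Type*} [NormedAddCommGroup H] [InnerProductSpace ℂ H] [CompleteSpace H]

/-- The operator `K* T K` with its natural domain `{x | K x ∈ D(T)}`. -/
def conjBy (K : H →L[ℂ] H) (T : H →ₗ.[ℂ] H) : H →ₗ.[ℂ] H where
  domain := T.domain.comap (K : H →ₗ[ℂ] H)
  toFun :=
    { toFun := fun x => ContinuousLinearMap.adjoint K (T ⟨K x, x.2⟩)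
      map_add' := fun x y => by
        rw [← map_add, ← LinearPMap.map_add]
        congr 2
        exact Subtype.ext (by simp)
      map_smul' := fun c x => by
        rw [RingHom.id_apply, ← map_smul, ← LinearPMap.map_smul]
        congr 2
        exact Subtype.ext (by simp) }

/-- A densely defined closable operator `T` is `K`-invariant, for a bounded and boundedly invertible
`K`, if `K* T K = T` (equality of operators, domains included). -/
structure IsKInvariant (K : H ≃L[ℂ] H) (T : H →ₗ.[ℂ] H) : Prop where
  dense_domain : Dense (T.domain : Set H)
  isClosable : T.IsClosable
  conjBy_eq : conjBy (K : H →L[ℂ] H) T = T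

end Invariance

end KInv

end

/-!
Since `⟨u, K* A K v⟩ = ⟨K u, A K v⟩`, the operator `K` carries the form of `K* A K` to the form of
`A`, hence form-convergent sequences, the form domain and the closed form of one to those of the
other. The Friedrichs extension is determined by these data, so it commutes with conjugation:
`K* A_F K = (K* A K)_F`. Moreover `A_F` is closable because it is densely defined and accretive.
-/

namespace KInv

section Accretive

open RCLike

variable {𝕜 E : Type*} [RCLike 𝕜] [NormedAddCommGroup E] [InnerProductSpace 𝕜 E]

lemma eq_zero_of_forall_mem_dense_re_inner_nonneg {S : Set E} {w : E} (hS : Dense S)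
    (hw : ∀ v ∈ S, 0 ≤ re (inner 𝕜 v w)) : w = 0 := by
  have h_closed : IsClosed {v : E | 0 ≤ re (inner 𝕜 v w)} :=
    isClosed_le continuous_const (by fun_prop)
  have h_neg : 0 ≤ re (inner 𝕜 (-w) w) := closure_minimal hw h_closed (hS (-w))
  rw [inner_neg_left, map_neg, neg_nonneg] at h_neg
  exact re_inner_self_nonpos.1 h_neg

lemma re_inner_nonneg_of_forall_pos_add_smul {v w z : E}
    (h : ∀ ε : ℝ, 0 < ε → 0 ≤ re (inner 𝕜 v (w + (ε : 𝕜) • z))) : 0 ≤ re (inner 𝕜 v w) := by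
  have h_tendsto : Tendsto (fun ε : ℝ => re (inner 𝕜 v (w + (ε : 𝕜) • z))) (𝓝[>] 0)
      (𝓝 (re (inner 𝕜 v (w + ((0 : ℝ) : 𝕜) • z)))) :=
    (Continuous.tendsto (by fun_prop) 0).mono_left nhdsWithin_le_nhds
  rw [ofReal_zero, zero_smul, add_zero] at h_tendsto
  exact ge_of_tendsto h_tendsto (eventually_mem_nhdsWithin.mono h)

lemma re_inner_nonneg_of_mem_topologicalClosure_graph {T : E →ₗ.[𝕜] E}
    (hT : ∀ x : T.domain, 0 ≤ re (inner 𝕜 (x : E) (T x))) {p : E × E}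
    (hp : p ∈ T.graph.topologicalClosure) : 0 ≤ re (inner 𝕜 p.1 p.2) := by
  have h_closed : IsClosed {p : E × E | 0 ≤ re (inner 𝕜 p.1 p.2)} :=
    isClosed_le continuous_const (by fun_prop)
  refine closure_minimal ?_ h_closed hp
  rintro ⟨x, y⟩ hxy
  obtain ⟨u, rfl, rfl⟩ := (LinearPMap.mem_graph_iff T).1 hxy
  exact hT u

theorem isClosable_of_re_inner_nonneg {T : E →ₗ.[𝕜] E} (hT_dense : Dense (T.domain : Set E))
    (hT : ∀ x : T.domain, 0 ≤ re (inner 𝕜 (x : E) (T x))) : T.IsClosable := by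
  refine ⟨_, (Submodule.toLinearPMap_graph_eq T.graph.topologicalClosure ?_).symm⟩
  rintro ⟨x, w⟩ hw rfl
  refine eq_zero_of_forall_mem_dense_re_inner_nonneg (𝕜 := 𝕜) hT_dense fun v hv => ?_
  have hv_graph : (v, T ⟨v, hv⟩) ∈ T.graph.topologicalClosure :=
    T.graph.le_topologicalClosure (LinearPMap.mem_graph T ⟨v, hv⟩)
  -- `(ε v, w + ε T v)` lies in the closure of the graph; divide by `ε` and let `ε → 0`.
  refine re_inner_nonneg_of_forall_pos_add_smul (z := T ⟨v, hv⟩) fun ε hε => ?_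
  have h_nonneg := re_inner_nonneg_of_mem_topologicalClosure_graph hT
    (add_mem hw (Submodule.smul_mem _ (ε : 𝕜) hv_graph))
  simp only [Prod.smul_mk, Prod.mk_add_mk, zero_add, inner_smul_left, conj_ofReal,
    re_ofReal_mul] at h_nonneg
  exact nonneg_of_mul_nonneg_right h_nonneg hε

end Accretive

section Friedrichs

variable {H : Type*} [NormedAddCommGroup H] [InnerProductSpace ℂ H] {A : H →ₗ.[ℂ] H}

lemma neg_le_arg_form_self_le {η : ℝ} (hη : 0 ≤ η)
    (hA : numericalRange A ⊆ {z : ℂ | -η ≤ z.arg ∧ z.arg ≤ η}) (u : A.domain) :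
    -η ≤ (form A u u).arg ∧ (form A u u).arg ≤ η := by
  rcases eq_or_ne (u : H) 0 with hu | hu
  · simp [form, hu, hη]
  set r : ℝ := ‖(u : H)‖⁻¹ with hr
  have h_norm : ‖(((r : ℂ) • u : A.domain) : H)‖ = 1 := by
    simp [hr, norm_smul, hu]
  have h_form : form A ((r : ℂ) • u) ((r : ℂ) • u) = ((r ^ 2 : ℝ) : ℂ) * form A u u := by
    rw [form_smul_left, form_smul_right, Complex.conj_ofReal]
    push_cast
    ring
  have h_mem : ((r ^ 2 : ℝ) : ℂ) * form A u u ∈ numericalRange A := ⟨_, h_norm, h_form⟩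
  simpa only [Set.mem_ofPred_eq, Complex.arg_real_mul _ (by positivity : 0 < r ^ 2)] using hA h_mem

lemma re_closedForm_self_nonneg (hA : IsSectorial A) (u : formDomain A hA) :
    0 ≤ (closedForm A hA u u).re := by
  obtain ⟨f, hf⟩ := u.2
  exact ge_of_tendsto' ((Complex.continuous_re.tendsto _).comp (tendsto_closedForm hA u u hf hf))
    fun n => hA.re_nonneg (f n)

lemma mem_friedrichsGraph_iff (hA : IsSectorial A) {x y : H} :
    (x, y) ∈ friedrichsGraph A hA ↔ ∃ hx : x ∈ formDomain A hA,
      ∀ (v : H) (hv : v ∈ formDomain A hA), closedForm A hA ⟨v, hv⟩ ⟨x, hx⟩ = inner ℂ v y := by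
  constructor
  · rintro ⟨⟨_, hx⟩, rfl, h⟩
    exact ⟨hx, fun v hv => h ⟨v, hv⟩⟩
  · rintro ⟨hx, h⟩
    exact ⟨⟨x, hx⟩, rfl, fun v => h v v.2⟩

lemma re_inner_friedrichsExtension_nonneg (hA : IsSectorial A)
    (x : (friedrichsExtension A hA).domain) :
    0 ≤ (inner ℂ (x : H) (friedrichsExtension A hA x)).re := by
  have hx_graph := LinearPMap.mem_graph _ x
  rw [friedrichsExtension_graph, mem_friedrichsGraph_iff] at hx_graph
  obtain ⟨hx, h⟩ := hx_graph
  rw [← h x hx]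
  exact re_closedForm_self_nonneg hA ⟨x, hx⟩

lemma dense_domain_friedrichsExtension (hA : IsSectorial A) :
    Dense ((friedrichsExtension A hA).domain : Set H) :=
  hA.dense_domain.mono (le_friedrichsExtension A hA).1

theorem isClosable_friedrichsExtension (hA : IsSectorial A) :
    (friedrichsExtension A hA).IsClosable :=
  isClosable_of_re_inner_nonneg (dense_domain_friedrichsExtension hA)
    (re_inner_friedrichsExtension_nonneg hA)

end Friedrichs

section Conjugation

open ContinuousLinearMap (adjoint)

lemma adjoint_apply_eq_iff {𝕜 E F : Type*} [RCLike 𝕜] [NormedAddCommGroup E]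
    [InnerProductSpace 𝕜 E] [CompleteSpace E] [NormedAddCommGroup F] [InnerProductSpace 𝕜 F]
    [CompleteSpace F] (K : E ≃L[𝕜] F) {y : E} {z : F} :
    adjoint (K : E →L[𝕜] F) z = y ↔ z = adjoint (K.symm : F →L[𝕜] E) y := by
  constructor <;> rintro rfl <;>
    exact ext_inner_left 𝕜 fun v => by simp [ContinuousLinearMap.adjoint_inner_right]

variable {H : Type*} [NormedAddCommGroup H] [InnerProductSpace ℂ H] [CompleteSpace H]
  {A : H →ₗ.[ℂ] H}

lemma mem_graph_conjBy_iff (K : H ≃L[ℂ] H) (T : H →ₗ.[ℂ] H) {x y : H} :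
    (x, y) ∈ (conjBy (K : H →L[ℂ] H) T).graph ↔
      (K x, adjoint (K.symm : H →L[ℂ] H) y) ∈ T.graph := by
  simp only [LinearPMap.mem_graph_iff]
  constructor
  · rintro ⟨u, rfl, h⟩
    exact ⟨⟨K u, u.2⟩, rfl, (adjoint_apply_eq_iff K).1 h⟩
  · rintro ⟨⟨_, hx⟩, rfl, h⟩
    exact ⟨⟨x, hx⟩, rfl, (adjoint_apply_eq_iff K).2 h⟩

lemma form_conjBy (K : H →L[ℂ] H) (u v : (conjBy K A).domain) :
    form (conjBy K A) u v = form A ⟨K u, u.2⟩ ⟨K v, v.2⟩ :=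
  K.adjoint_inner_right u (A ⟨K v, v.2⟩)

variable (K : H ≃L[ℂ] H)

lemma IsSectorial.conjBy (hA : IsSectorial A) : IsSectorial (conjBy (K : H →L[ℂ] H) A) where
  dense_domain := hA.dense_domain.preimage K.isOpenMap
  numericalRange_subset := by
    obtain ⟨η, hη, hη_lt, hA_range⟩ := hA.numericalRange_subset
    refine ⟨η, hη, hη_lt, ?_⟩
    rintro _ ⟨ψ, -, rfl⟩
    have h_form : inner ℂ (ψ : H) (KInv.conjBy (K : H →L[ℂ] H) A ψ) =
        form A ⟨K ψ, ψ.2⟩ ⟨K ψ, ψ.2⟩ := form_conjBy (K : H →L[ℂ] H) ψ ψ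
    rw [h_form]
    exact neg_le_arg_form_self_le hη hA_range _

lemma formConverges_conjBy_iff (hA : IsSectorial A) {u : H}
    {f : ℕ → (conjBy (K : H →L[ℂ] H) A).domain} :
    FormConverges (conjBy (K : H →L[ℂ] H) A) f u ↔
      FormConverges A (fun n => ⟨K (f n), (f n).2⟩) (K u) := by
  rw [formConverges_iff (hA.conjBy K), formConverges_iff hA,
    K.toHomeomorph.isInducing.tendsto_nhds_iff]
  refine and_congr Iff.rfl (tendsto_congr fun p => ?_)
  rw [form_conjBy]
  congr 2 <;> exact Subtype.ext (map_sub K _ _)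

lemma mem_formDomain_conjBy_iff (hA : IsSectorial A) {x : H} :
    x ∈ formDomain (conjBy (K : H →L[ℂ] H) A) (hA.conjBy K) ↔ K x ∈ formDomain A hA := by
  constructor
  · rintro ⟨f, hf⟩
    exact ⟨_, (formConverges_conjBy_iff K hA).1 hf⟩
  · rintro ⟨g, hg⟩
    have hg_symm (n : ℕ) : K (K.symm (g n)) ∈ A.domain := by simp
    refine ⟨fun n => ⟨K.symm (g n), hg_symm n⟩, (formConverges_conjBy_iff K hA).2 ?_⟩
    simpa only [K.apply_symm_apply] using hg

lemma closedForm_conjBy (hA : IsSectorial A)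
    (u v : formDomain (conjBy (K : H →L[ℂ] H) A) (hA.conjBy K)) :
    closedForm (conjBy (K : H →L[ℂ] H) A) (hA.conjBy K) u v =
      closedForm A hA ⟨K u, (mem_formDomain_conjBy_iff K hA).1 u.2⟩
        ⟨K v, (mem_formDomain_conjBy_iff K hA).1 v.2⟩ := by
  obtain ⟨f, hf⟩ := u.2
  obtain ⟨g, hg⟩ := v.2
  refine tendsto_nhds_unique (tendsto_closedForm (hA.conjBy K) u v hf hg) ?_
  simpa only [form_conjBy] using tendsto_closedForm hA _ _
    ((formConverges_conjBy_iff K hA).1 hf) ((formConverges_conjBy_iff K hA).1 hg)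

lemma mem_friedrichsGraph_conjBy_iff (hA : IsSectorial A) {x y : H} :
    (x, y) ∈ friedrichsGraph (conjBy (K : H →L[ℂ] H) A) (hA.conjBy K) ↔
      (K x, adjoint (K.symm : H →L[ℂ] H) y) ∈ friedrichsGraph A hA := by
  rw [mem_friedrichsGraph_iff, mem_friedrichsGraph_iff]
  have h_inner (v : H) : inner ℂ (K v) (adjoint (K.symm : H →L[ℂ] H) y) = inner ℂ v y := by
    rw [ContinuousLinearMap.adjoint_inner_right, ContinuousLinearEquiv.coe_coe, K.symm_apply_apply]
  constructor
  · rintro ⟨hx, h⟩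
    refine ⟨(mem_formDomain_conjBy_iff K hA).1 hx, K.surjective.forall.2 fun v hv => ?_⟩
    rw [h_inner, ← h v ((mem_formDomain_conjBy_iff K hA).2 hv), closedForm_conjBy]
  · rintro ⟨hx, h⟩
    refine ⟨(mem_formDomain_conjBy_iff K hA).2 hx, fun v hv => ?_⟩
    rw [closedForm_conjBy K hA, h, h_inner]

theorem conjBy_friedrichsExtension (hA : IsSectorial A) :
    conjBy (K : H →L[ℂ] H) (friedrichsExtension A hA) =
      friedrichsExtension (conjBy (K : H →L[ℂ] H) A) (hA.conjBy K) := by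
  refine LinearPMap.eq_of_eq_graph (Submodule.ext fun ⟨x, y⟩ => ?_)
  rw [mem_graph_conjBy_iff, friedrichsExtension_graph, friedrichsExtension_graph,
    mem_friedrichsGraph_conjBy_iff]

end Conjugation

end KInv

theorem mainTheorem3 {H : Type*} [NormedAddCommGroup H] [InnerProductSpace ℂ H] [CompleteSpace H]
    (K : H ≃L[ℂ] H) (A : H →ₗ.[ℂ] H) (hA : KInv.IsSectorial A)
    (hKA : KInv.conjBy (K : H →L[ℂ] H) A = A) :
    KInv.IsKInvariant K (KInv.friedrichsExtension A hA) := by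
  refine ⟨KInv.dense_domain_friedrichsExtension hA, KInv.isClosable_friedrichsExtension hA, ?_⟩
  rw [KInv.conjBy_friedrichsExtension]
  simp only [hKA]
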